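/- Let $q$ be a power of a prime $p$, let $k\ge 1$, and let $M$ be a non-singular $k\times k$ matrix over $\mathbb F_{q^2}$ such that $$(M^{\sigma})^{t}=-\lambda^{q+1}M^{-1}$$ for some non-zero $\lambda\in\mathbb F_{q^2}$, where $M^\sigma$ is obtained from $M$ by applying $x\mapsto x^q$ to every entry. Suppose that every $j\times j$ submatrix of $M$ is non-singular for all $j=1,\dots,\lfloor k/2\rfloor$. Then the linear code $C\le\mathbb F_{q^2}^{2k}$ spanned by the rows of $(\lambda I_k\mid M)$ has dimension $k$ and minimum distance $k+1$ (so it is a $[2k,k,k+1]_{q^2}$ MDS code), and $C$ is Hermitian self-dual, that is, $C=\{v\in\mathbb F_{q^2}^{2k} : \sum_i u_iv_i^{q}=0 \text{ for all } u\in C\}$. Moreover, for every $r=0,\dots,k-1$ there exists a $[\![2k-r,\,r,\,k+1-r]\!]_q$ quantum MDS code. Here an $[\![n,m,d]\!]_q$ quantum code is a subspace $Q$ of $(\mathbb C^q)^{\otimes n}$ of dimension $q^m$ and minimum distance $d$, and it is MDS if $m=n-2d+2$. Let $|x\rangle$, $x\in\mathbb F_q$, be an orthonormal basis of $\mathbb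 C^q$. A Pauli error is an operator $E=E_1\otimes\cdots\otimes E_n$ in which each $E_i$ is of the form $X(a)Z(b)$ with $a,b\in\mathbb F_q$, where $X(a)|x\rangle=|x+a\rangle$ and $Z(b)|x\rangle=e^{2\pi i\,\mathrm{tr}(bx)/p}|x\rangle$, with $\mathrm{tr}$ the trace from $\mathbb F_q$ to $\mathbb F_p$. Its weight is the number of $i$ with $E_i\ne 1$. With $P$ the orthogonal projection onto $Q$, the minimum distance of $Q$ is the least weight of a Pauli error $E$ for which $PEP$ is not a scalar multiple of $P$ if $\dim Q\ge 2$, and the least weight of a Pauli error $E\neq 1$ with $PEP\ne 0$ if $\dim Q=1$. -/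

import Mathlib

open scoped Matrix

noncomputable section

namespace QMDS

/-! ### Classical codes -/

/-- `d` is the minimum distance of the code `C`: the least number of coordinates in which two
distinct codewords differ. -/
def IsMinDist {ι A : Type*} [Fintype ι] [DecidableEq A] (C : Set (ι → A)) (d : ℕ) : Prop :=
  IsLeast {w : ℕ | ∃ u ∈ C, ∃ v ∈ C, u ≠ v ∧ hammingDist u v = w} d

/-- `C` is an `[n, k, d]` linear code over `K`: it has length `n`, dimension `k` and minimum
distance `d`. -/
structure IsLinearCode {ι K : Type*} [Fintype ι] [Field K] [DecidableEq K]
    (C : Submodule K (ι → K)) (n k d : ℕ) : Prop where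
  length_eq : Fintype.card ι = n
  finrank_eq : Module.finrank K C = k
  minDist : IsMinDist (C : Set (ι → K)) d

/-- `C` is a maximum distance separable code: it meets the Singleton bound
`|C| ≤ |A| ^ (n - d + 1)`, where `n` is its length and `d` its minimum distance. -/
def IsMDS {ι A : Type*} [Fintype ι] [Fintype A] [DecidableEq A] (C : Set (ι → A)) : Prop :=
  ∃ d : ℕ, IsMinDist C d ∧ Nat.card C = Fintype.card A ^ (Fintype.card ι - d + 1)

/-- The Hermitian form `u₁ v₁ ^ q + ⋯ + uₙ vₙ ^ q`. -/
def hermitianForm {ι K : Type*} [Fintype ι] [Field K] (q : ℕ) (u v : ι → K) : K :=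
  ∑ i, u i * v i ^ q

/-- The Hermitian dual of a linear code. -/
def hermitianDual {ι K : Type*} [Fintype ι] [Field K] (q : ℕ) (C : Submodule K (ι → K)) :
    Set (ι → K) :=
  {v | ∀ u ∈ C, hermitianForm q u v = 0}

/-- The linear code spanned by the rows of `(lam • I | M)`. -/
def doubleCode {K : Type*} [Field K] {k : ℕ} (lam : K) (M : Matrix (Fin k) (Fin k) K) :
    Submodule K (Fin k ⊕ Fin k → K) :=
  Submodule.span K (Set.range (Matrix.fromCols (lam • (1 : Matrix (Fin k) (Fin k) K)) M).row)

/-! ### Quantum codes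

For a field `F` with `q` elements, `ℂ ^ q` is the space with basis `|x⟩`, `x ∈ F`, and its `n`-th
tensor power is the space `(Fin n → F) → ℂ` with basis `|x₁⟩ ⊗ ⋯ ⊗ |xₙ⟩` and the standard
Hermitian inner product `star u ⬝ᵥ v`. Operators are matrices in these bases. -/

/-- The operator `X(a) : |x⟩ ↦ |x + a⟩`. -/
def pauliX {F : Type*} [Field F] [DecidableEq F] (a : F) : Matrix F F ℂ :=
  Matrix.of fun y x => if y = x + a then 1 else 0

/-- The operator `Z(b) : |x⟩ ↦ exp (2πi tr(b x) / p) |x⟩`; `ZMod.stdAddChar` is the character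
`j ↦ exp (2πi j / p)` of `ℤ/p`. -/
def pauliZ (p : ℕ) [Fact p.Prime] {F : Type*} [Field F] [DecidableEq F] [Algebra (ZMod p) F]
    (b : F) : Matrix F F ℂ :=
  Matrix.diagonal fun x => ZMod.stdAddChar (Algebra.trace (ZMod p) F (b * x))

/-- The generalised Pauli operators `X(a) Z(b)`. -/
def IsPauli (p : ℕ) [Fact p.Prime] {F : Type*} [Field F] [Fintype F] [DecidableEq F]
    [Algebra (ZMod p) F] (A : Matrix F F ℂ) : Prop :=
  ∃ a b : F, A = pauliX a * pauliZ p b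

/-- The tensor product `E₁ ⊗ ⋯ ⊗ Eₙ` of operators on `ℂ ^ q`. -/
def tensorOp {F : Type*} {n : ℕ} (E : Fin n → Matrix F F ℂ) :
    Matrix (Fin n → F) (Fin n → F) ℂ :=
  Matrix.of fun y x => ∏ i, E i (y i) (x i)

/-- The weight of an error `E₁ ⊗ ⋯ ⊗ Eₙ`: the number of components that are not the identity. -/
def weight {F : Type*} [DecidableEq F] {n : ℕ} (E : Fin n → Matrix F F ℂ) : ℕ :=
  Set.ncard {i | E i ≠ 1}

/-- The code `Q` detects the operator `T`: if `P` is the orthogonal projection onto `Q`, then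
`P T P = c P` for some scalar `c`. -/
def Detects {ι : Type*} [Fintype ι] (Q : Submodule ℂ (ι → ℂ)) (T : Matrix ι ι ℂ) : Prop :=
  ∃ c : ℂ, ∀ u ∈ Q, ∀ v ∈ Q, star u ⬝ᵥ (T *ᵥ v) = c * (star u ⬝ᵥ v)

/-- The error `E₁ ⊗ ⋯ ⊗ Eₙ` counts against the minimum distance of `Q`: it is not detected by `Q`
or, if `Q` is one-dimensional (when every operator is detected), it is not the identity and
does not map `Q` to its orthogonal complement. The latter is the usual convention for
one-dimensional codes. -/
def Confuses {F : Type*} [Fintype F] [DecidableEq F] {n : ℕ}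
    (Q : Submodule ℂ ((Fin n → F) → ℂ)) (E : Fin n → Matrix F F ℂ) : Prop :=
  ¬ Detects Q (tensorOp E) ∨
    (Module.finrank ℂ Q = 1 ∧ weight E ≠ 0 ∧ ∃ u ∈ Q, star u ⬝ᵥ (tensorOp E *ᵥ u) ≠ 0)

/-- `d` is the minimum distance of the quantum code `Q`: all Pauli errors on at most `d - 1`
subsystems are dealt with, and `d` cannot be enlarged. -/
def IsQuantumMinDist (p : ℕ) [Fact p.Prime] {F : Type*} [Field F] [Fintype F] [DecidableEq F]
    [Algebra (ZMod p) F] {n : ℕ} (Q : Submodule ℂ ((Fin n → F) → ℂ)) (d : ℕ) : Prop :=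
  IsLeast {w : ℕ | ∃ E : Fin n → Matrix F F ℂ,
    (∀ i, IsPauli p (E i)) ∧ weight E = w ∧ Confuses Q E} d

/-- `Q` is an `[[n, k, d]]_q` quantum code, `q = |F|`. -/
structure IsQuantumCode (p : ℕ) [Fact p.Prime] {F : Type*} [Field F] [Fintype F] [DecidableEq F]
    [Algebra (ZMod p) F] (n k d : ℕ) (Q : Submodule ℂ ((Fin n → F) → ℂ)) : Prop where
  finrank_eq : Module.finrank ℂ Q = Fintype.card F ^ k
  minDist : IsQuantumMinDist p Q d

/-- `Q` is an `[[n, k, d]]_q` quantum MDS code: it attains the quantum Singleton bound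
`k ≤ n - 2 d + 2`. -/
structure IsQuantumMDS (p : ℕ) [Fact p.Prime] {F : Type*} [Field F] [Fintype F] [DecidableEq F]
    [Algebra (ZMod p) F] (n k d : ℕ) (Q : Submodule ℂ ((Fin n → F) → ℂ)) : Prop where
  isQuantumCode : IsQuantumCode p n k d Q
  singleton_eq : (k : ℤ) = (n : ℤ) - 2 * (d : ℤ) + 2

end QMDS

end

/-! ### The classical code -/

namespace QMDS

section Classical

variable {K : Type*} [Field K] {k : ℕ}

/-! Write `N` for the conjugate transpose of `M`, so that `M * N` is a non-zero scalar matrix. A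
codeword is `(lam u | uM)`. If its weight is at most `k`, then `u` or `uM` has weight at most `k /
2`. In the first case `uM` has at least as many zeros as `u` has non-zero entries, which makes a
square submatrix of `M` singular; in the second the same argument runs with `N`, whose minors are
conjugates of minors of `M` (`le_hammingNorm_of_mem_doubleCode`). Multiplying the orthogonality
equations by `N` gives self-duality (`hermitianDual_doubleCode`).

For the quantum codes, puncture `C` in `r` coordinates to get `D`. A vector of the Hermitian dual of
`D`, extended by zero, lies in the dual of `C`, which is `C`; hence `D` contains its dual. In a
basis `1, β` of `K` over `F`, the code `D` becomes an `F`-space `T` of dimension `n + r` containing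
its symplectic dual `S`. A joint eigenspace of the Weyl operators of `S` has dimension `q ^ r`
(`finrank_stabilizerCode`). Errors outside `T` are annihilated by the projections, and errors in `T
\ S` are not detected, so the distance is the least weight in `T \ S`, or in `T \ {0}` when `r = 0`
(`exists_isQuantumCode`). A lightest word of `T` is not in `S` if `r > 0`, since words of `S` extend
by zero to words of `C`, which are heavier by `r`. -/

/-- A vector supported on `s` whose image under a matrix vanishes on `t` is zero if the minors of
size `|s| = |t|` do not vanish. -/
theorem eq_zero_of_support_subset {N : Matrix (Fin k) (Fin k) K} {s t : Finset (Fin k)}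
    (hst : s.card = t.card)
    (hN : ∀ f g : Fin s.card ↪o Fin k, (N.submatrix f g).det ≠ 0) {x : Fin k → K}
    (hx : ∀ i, i ∉ s → x i = 0) (hy : ∀ j ∈ t, (x ᵥ* N) j = 0) : x = 0 := by
  set f := s.orderEmbOfFin rfl with hf
  set g := t.orderEmbOfFin hst.symm with hg
  have hfx : (fun i => x (f i)) = 0 := by
    by_contra hne
    refine hN f g (Matrix.exists_vecMul_eq_zero_iff.1 ⟨_, hne, ?_⟩)
    ext j
    have := hy (g j) (Finset.orderEmbOfFin_mem t hst.symm j)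
    rw [Matrix.vecMul, dotProduct,
      ← Finset.sum_subset (Finset.subset_univ s) (fun i _ hi => by rw [hx i hi, zero_mul])] at this
    rw [Matrix.vecMul, dotProduct, Pi.zero_apply, ← this]
    refine Eq.trans ?_ (congrArg (fun a => ∑ i ∈ a, x i * N i (g j))
      (Finset.map_orderEmbOfFin_univ s rfl))
    rw [Finset.sum_map]
    rfl
  ext i
  by_cases hi : i ∈ s
  · obtain ⟨j, rfl⟩ : i ∈ Set.range f := by
      rw [hf, Finset.range_orderEmbOfFin]; exact hi
    exact congrFun hfx j
  · exact hx i hi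

theorem eq_zero_of_hammingNorm_add_le [DecidableEq K] {N : Matrix (Fin k) (Fin k) K}
    (hN : ∀ j : ℕ, 1 ≤ j → j ≤ k / 2 → ∀ f g : Fin j ↪o Fin k, (N.submatrix f g).det ≠ 0)
    {x : Fin k → K} (hx : hammingNorm x ≤ k / 2) (hw : hammingNorm x + hammingNorm (x ᵥ* N) ≤ k) :
    x = 0 := by
  rcases Nat.eq_zero_or_pos (hammingNorm x) with h0 | h0
  · exact hammingNorm_eq_zero.1 h0
  have hc : hammingNorm x ≤ (Finset.univ.filter fun j => (x ᵥ* N) j = 0).card := by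
    have := Finset.card_filter_add_card_filter_not (s := (Finset.univ : Finset (Fin k)))
      (fun j => (x ᵥ* N) j = 0)
    rw [Finset.card_univ, Fintype.card_fin] at this
    have h2 : hammingNorm (x ᵥ* N) = (Finset.univ.filter fun j => ¬ (x ᵥ* N) j = 0).card := rfl
    omega
  obtain ⟨t, ht, htc⟩ := Finset.exists_subset_card_eq hc
  refine eq_zero_of_support_subset (N := N) (s := Finset.univ.filter fun i => x i ≠ 0) (t := t)
    htc.symm (hN _ h0 hx) (fun i hi => ?_) (fun j hj => (Finset.mem_filter.1 (ht hj)).2)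
  simpa using hi

theorem hammingNorm_sumElim [DecidableEq K] {m n : Type*} [Fintype m] [Fintype n] (x : m → K) (y : n → K) :
    hammingNorm (Sum.elim x y) = hammingNorm x + hammingNorm y := by
  simp only [hammingNorm, ← Fintype.card_subtype]
  rw [Fintype.card_congr (Equiv.subtypeSum (p := fun i => Sum.elim x y i ≠ 0)), Fintype.card_sum]
  rfl

variable {lam : K} {M : Matrix (Fin k) (Fin k) K}

theorem mem_doubleCode {v : Fin k ⊕ Fin k → K} :
    v ∈ doubleCode lam M ↔ ∃ u : Fin k → K, v = Sum.elim (lam • u) (u ᵥ* M) := by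
  rw [doubleCode, ← range_vecMulLinear, LinearMap.mem_range]
  refine exists_congr fun u => ?_
  rw [Matrix.vecMulLinear_apply, Matrix.vecMul_fromCols, Matrix.vecMul_smul, Matrix.vecMul_one,
    eq_comm]

theorem finrank_doubleCode (hlam : lam ≠ 0) : Module.finrank K (doubleCode lam M) = k := by
  rw [doubleCode, ← range_vecMulLinear, LinearMap.finrank_range_of_inj]
  · simp
  · intro u v h
    simp only [Matrix.vecMulLinear_apply, Matrix.vecMul_fromCols, Matrix.vecMul_smul,
      Matrix.vecMul_one] at h
    ext i
    have := congrFun h (Sum.inl i)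
    simpa [hlam] using this

theorem le_hammingNorm_of_mem_doubleCode [DecidableEq K] (hlam : lam ≠ 0) {N : Matrix (Fin k) (Fin k) K} {c : K}
    (hc : c ≠ 0) (hMN : M * N = c • 1)
    (hM : ∀ j : ℕ, 1 ≤ j → j ≤ k / 2 → ∀ f g : Fin j ↪o Fin k, (M.submatrix f g).det ≠ 0)
    (hN : ∀ j : ℕ, 1 ≤ j → j ≤ k / 2 → ∀ f g : Fin j ↪o Fin k, (N.submatrix f g).det ≠ 0)
    {v : Fin k ⊕ Fin k → K} (hv : v ∈ doubleCode lam M) (hv0 : v ≠ 0) :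
    k + 1 ≤ hammingNorm v := by
  obtain ⟨u, rfl⟩ := mem_doubleCode.1 hv
  by_contra hlt
  have hsm : hammingNorm (lam • u) = hammingNorm u :=
    hammingNorm_smul (fun _ => (IsUnit.mk0 lam hlam).isSMulRegular _) u
  rw [hammingNorm_sumElim, hsm] at hlt
  suffices hu : u = 0 by
    subst hu; exact hv0 (by ext (i | i) <;> simp)
  by_cases h : hammingNorm u ≤ k / 2
  · exact eq_zero_of_hammingNorm_add_le hM h (by omega)
  -- More than `k / 2` of at most `k` non-zero entries lie in `u`, so `u ᵥ* M` is the light half;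
  -- `N` carries it to a multiple of `u`, which exchanges the two roles.
  · have huN : (u ᵥ* M) ᵥ* N = c • u := by
      rw [Matrix.vecMul_vecMul, hMN, Matrix.vecMul_smul, Matrix.vecMul_one]
    have hw : u ᵥ* M = 0 := by
      refine eq_zero_of_hammingNorm_add_le hN (by omega) ?_
      rw [huN, hammingNorm_smul (fun _ => (IsUnit.mk0 c hc).isSMulRegular _)]
      omega
    rw [hw, Matrix.zero_vecMul] at huN
    exact (smul_eq_zero.1 huN.symm).resolve_left hc

theorem row_mem_doubleCode (i : Fin k) :
    Sum.elim (lam • Pi.single i 1) (M i) ∈ doubleCode lam M :=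
  mem_doubleCode.2 ⟨Pi.single i 1, by rw [Matrix.single_one_vecMul]; rfl⟩

theorem isMinDist_of_hammingNorm [DecidableEq K] {ι : Type*} [Fintype ι] {C : Submodule K (ι → K)} {d : ℕ}
    (h : ∀ v ∈ C, v ≠ 0 → d ≤ hammingNorm v) (hd : ∃ v ∈ C, v ≠ 0 ∧ hammingNorm v ≤ d) :
    IsMinDist (C : Set (ι → K)) d := by
  constructor
  · obtain ⟨v, hv, hv0, hvd⟩ := hd
    exact ⟨v, hv, 0, C.zero_mem, hv0, by
      rw [hammingDist_zero_right]; exact le_antisymm hvd (h v hv hv0)⟩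
  · rintro w ⟨u, hu, v, hv, huv, rfl⟩
    rw [hammingDist_eq_hammingNorm]
    exact h _ (C.add_mem (C.neg_mem hu) hv) fun h0 => huv (neg_add_eq_zero.1 h0)

theorem hammingNorm_row_le [DecidableEq K] (i : Fin k) {n : ℕ} (y : Fin n → K) :
    hammingNorm (Sum.elim (lam • Pi.single i 1 : Fin k → K) y) ≤ n + 1 := by
  rw [hammingNorm_sumElim, add_comm]
  refine Nat.add_le_add (hammingNorm_le_card_fintype.trans_eq (Fintype.card_fin n)) ?_
  refine (Finset.card_le_card (t := {i}) fun j hj => ?_).trans_eq (Finset.card_singleton i)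
  by_contra hne
  simp only [Finset.mem_singleton] at hne
  simp [Pi.single_apply, hne] at hj

theorem mem_hermitianDual_doubleCode_iff {q : ℕ} {v : Fin k ⊕ Fin k → K} (σ : K →+* K)
    (hσ : ∀ x, σ x = x ^ q) :
    v ∈ hermitianDual q (doubleCode lam M) ↔
      lam • (σ ∘ v ∘ Sum.inl) + M *ᵥ (σ ∘ v ∘ Sum.inr) = 0 := by
  have key : ∀ u : Fin k → K, hermitianForm q (Sum.elim (lam • u) (u ᵥ* M)) v =
      u ⬝ᵥ (lam • (σ ∘ v ∘ Sum.inl) + M *ᵥ (σ ∘ v ∘ Sum.inr)) := by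
    intro u
    rw [dotProduct_add, Matrix.dotProduct_mulVec, dotProduct_smul, ← smul_dotProduct]
    simp only [hermitianForm, Fintype.sum_sum_type, Sum.elim_inl, Sum.elim_inr, ← hσ]
    rfl
  constructor
  · intro h
    refine dotProduct_eq_zero _ fun u => ?_
    rw [dotProduct_comm, ← key]
    exact h _ (mem_doubleCode.2 ⟨u, rfl⟩)
  · rintro h u hu
    obtain ⟨u, rfl⟩ := mem_doubleCode.1 hu
    rw [key, h, dotProduct_zero]

theorem hermitianDual_doubleCode (hlam : lam ≠ 0) {q : ℕ} (σ : K →+* K) (hσ : ∀ x, σ x = x ^ q)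
    (hMN : M * (M.map σ)ᵀ = -(lam ^ (q + 1)) • (1 : Matrix (Fin k) (Fin k) K))
    (hNM : (M.map σ)ᵀ * M = -(lam ^ (q + 1)) • (1 : Matrix (Fin k) (Fin k) K)) :
    hermitianDual q (doubleCode lam M) = doubleCode lam M := by
  have hmap : ∀ u : Fin k → K, σ ∘ (u ᵥ* M) = (M.map σ)ᵀ *ᵥ (σ ∘ u) := by
    intro u
    rw [Matrix.mulVec_transpose]
    ext j
    exact RingHom.map_vecMul σ M u j
  ext v
  rw [mem_hermitianDual_doubleCode_iff σ hσ, SetLike.mem_coe, mem_doubleCode]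
  constructor
  · intro h
    refine ⟨lam⁻¹ • (v ∘ Sum.inl), ?_⟩
    -- The vector `u` is forced by the left block. The right block is compared after applying the
    -- injective `σ`, where multiplication by the conjugate transpose solves the equation.
    have h2 := congrArg (fun w => (M.map σ)ᵀ *ᵥ w) h
    simp only [Matrix.mulVec_add, Matrix.mulVec_smul, Matrix.mulVec_mulVec, hNM,
      Matrix.smul_mulVec, Matrix.one_mulVec, Matrix.mulVec_zero] at h2
    have h3 : σ ∘ ((lam⁻¹ • (v ∘ Sum.inl)) ᵥ* M) = σ ∘ v ∘ Sum.inr := by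
      rw [hmap]
      have : σ ∘ (lam⁻¹ • (v ∘ Sum.inl)) = (lam ^ q)⁻¹ • (σ ∘ v ∘ Sum.inl) := by
        ext i; simp [hσ, mul_pow]
      rw [this, Matrix.mulVec_smul]
      ext i
      have h4 := congrFun h2 i
      simp only [Pi.add_apply, Pi.smul_apply, smul_eq_mul, Pi.zero_apply] at h4 ⊢
      rw [inv_mul_eq_iff_eq_mul₀ (pow_ne_zero _ hlam)]
      refine mul_left_cancel₀ hlam ?_
      rw [pow_succ] at h4
      linear_combination h4
    ext (i | i)
    · simp [hlam]
    · exact σ.injective (congrFun h3 i).symm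
  · rintro ⟨u, rfl⟩
    simp only [Sum.elim_comp_inl, Sum.elim_comp_inr, hmap, Matrix.mulVec_mulVec, hMN,
      Matrix.smul_mulVec, Matrix.one_mulVec]
    ext i
    simp [hσ]
    ring

end Classical

end QMDS

/-! ### Stabilizer codes -/

noncomputable section

namespace QMDS

open scoped ComplexOrder in
theorem complex_star_dotProduct_self_eq_zero {n : Type*} [Fintype n] {v : n → ℂ} :
    star v ⬝ᵥ v = 0 ↔ v = 0 := dotProduct_star_self_eq_zero

/-- A minimal non-zero invariant subspace meets an eigenspace of each `f i` in a non-zero subspace,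
which is invariant by commutativity and hence everything. So every `f i` is scalar on it. -/
theorem exists_joint_eigenvector {J V : Type*} [AddCommGroup V] [Module ℂ V]
    [FiniteDimensional ℂ V] [Nontrivial V] (f : J → Module.End ℂ V)
    (hf : ∀ i j, Commute (f i) (f j)) :
    ∃ v : V, v ≠ 0 ∧ ∃ χ : J → ℂ, ∀ i, f i v = χ i • v := by
  obtain ⟨U, ⟨hU0, hUf⟩, hmin⟩ := WellFounded.has_min
    (wellFounded_lt (α := Submodule ℂ V)) {U | U ≠ ⊥ ∧ ∀ i, ∀ v ∈ U, f i v ∈ U}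
    ⟨⊤, top_ne_bot, fun _ _ _ => Submodule.mem_top⟩
  have key : ∀ i, ∃ c : ℂ, ∀ v ∈ U, f i v = c • v := by
    intro i
    have : Nontrivial U := Submodule.nontrivial_iff_ne_bot.2 hU0
    obtain ⟨c, hc⟩ := Module.End.exists_eigenvalue ((f i).restrict (hUf i))
    obtain ⟨w, hw⟩ := hc.exists_hasEigenvector
    have hw' : f i w = c • (w : V) := congrArg Subtype.val hw.apply_eq_smul
    refine ⟨c, fun v hv => ?_⟩
    have hle : U ⊓ Module.End.eigenspace (f i) c = U := by
      refine (inf_le_left).eq_of_not_lt (hmin _ ⟨?_, ?_⟩)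
      · refine fun h => hw.2 (Subtype.ext ?_)
        have : (w : V) ∈ U ⊓ Module.End.eigenspace (f i) c :=
          ⟨w.2, Module.End.mem_eigenspace_iff.2 hw'⟩
        rwa [h, Submodule.mem_bot] at this
      · rintro j v ⟨hv, hvc⟩
        refine ⟨hUf j v hv, Module.End.mem_eigenspace_iff.2 ?_⟩
        rw [← Module.End.mul_apply, (hf i j).eq, Module.End.mul_apply,
          Module.End.mem_eigenspace_iff.1 hvc, map_smul]
    rw [← hle] at hv
    exact Module.End.mem_eigenspace_iff.1 hv.2
  choose χ hχ using key
  obtain ⟨v, hv, hv0⟩ := Submodule.exists_mem_ne_zero_of_ne_bot hU0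
  exact ⟨v, hv0, χ, fun i => hχ i v hv⟩

/-! ### Weyl operators: commutation, unitarity and traces. -/

section Weyl

variable {F ι : Type*} [Field F] [Fintype ι]

/-- The symplectic form `b ⬝ᵥ a' - b' ⬝ᵥ a` on pairs of vectors. -/
def symplecticForm (F ι : Type*) [Field F] [Fintype ι] :
    LinearMap.BilinForm F ((ι → F) × (ι → F)) :=
  LinearMap.mk₂ F (fun e e' : (ι → F) × (ι → F) => e.2 ⬝ᵥ e'.1 - e'.2 ⬝ᵥ e.1)
    (fun e₁ e₂ e' => by
      rw [Prod.fst_add, Prod.snd_add, add_dotProduct, dotProduct_add, add_sub_add_comm])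
    (fun c e e' => by
      rw [Prod.smul_fst, Prod.smul_snd, smul_dotProduct, dotProduct_smul, smul_sub])
    (fun e e₁ e₂ => by
      rw [Prod.fst_add, Prod.snd_add, add_dotProduct, dotProduct_add, add_sub_add_comm])
    (fun c e e' => by
      rw [Prod.smul_fst, Prod.smul_snd, smul_dotProduct, dotProduct_smul, smul_sub])

theorem symplecticForm_apply (e e' : (ι → F) × (ι → F)) :
    symplecticForm F ι e e' = e.2 ⬝ᵥ e'.1 - e'.2 ⬝ᵥ e.1 := rfl

theorem symplecticForm_neg (e e' : (ι → F) × (ι → F)) :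
    symplecticForm F ι e e' = -symplecticForm F ι e' e := by
  simp only [symplecticForm_apply]; ring

theorem symplecticForm_isRefl : (symplecticForm F ι).IsRefl := fun e e' h => by
  rw [symplecticForm_neg, h, neg_zero]

theorem symplecticForm_nondegenerate : (symplecticForm F ι).Nondegenerate := by
  have h1 : ∀ e : (ι → F) × (ι → F), (∀ e', symplecticForm F ι e e' = 0) → e = 0 := by
    intro e h
    refine Prod.ext (dotProduct_eq_zero _ fun b => ?_) (dotProduct_eq_zero _ fun a => ?_)
    · simpa [symplecticForm_apply, dotProduct_comm] using h (0, b)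
    · simpa [symplecticForm_apply] using h (a, 0)
  exact ⟨h1, fun e h => h1 e fun e' => by rw [symplecticForm_neg, h, neg_zero]⟩

variable [DecidableEq F] (ψ : AddChar F ℂ)

/-- The operator `X(a) Z(b)` on several subsystems, where `e = (a, b)`. -/
def weyl (e : (ι → F) × (ι → F)) : Matrix (ι → F) (ι → F) ℂ :=
  Matrix.of fun y x => if y = x + e.1 then ψ (e.2 ⬝ᵥ x) else 0

theorem weyl_apply (e : (ι → F) × (ι → F)) (y x : ι → F) :
    weyl ψ e y x = if y = x + e.1 then ψ (e.2 ⬝ᵥ x) else 0 := rfl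

theorem weyl_zero : weyl ψ (0 : (ι → F) × (ι → F)) = 1 := by
  ext y x
  simp [weyl_apply, Matrix.one_apply]

variable [DecidableEq ι] [Fintype F]

theorem weyl_mul (e e' : (ι → F) × (ι → F)) :
    weyl ψ e * weyl ψ e' = ψ (e.2 ⬝ᵥ e'.1) • weyl ψ (e + e') := by
  ext y x
  simp only [Matrix.mul_apply, weyl_apply, Matrix.smul_apply, mul_ite, mul_zero,
    Finset.sum_ite_eq', Finset.mem_univ, if_true, smul_eq_mul]
  simp only [ite_mul, zero_mul, Prod.fst_add, Prod.snd_add, ← AddChar.map_add_eq_mul, dotProduct_add, add_dotProduct]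
  rw [add_comm e.1, ← add_assoc]
  congr 2
  ring

theorem weyl_mul_comm (e e' : (ι → F) × (ι → F)) :
    weyl ψ e * weyl ψ e' = ψ (symplecticForm F ι e e') • (weyl ψ e' * weyl ψ e) := by
  rw [weyl_mul, weyl_mul, smul_smul, ← AddChar.map_add_eq_mul, symplecticForm_apply,
    sub_add_cancel, add_comm e]

theorem conjTranspose_weyl_mul (e : (ι → F) × (ι → F)) : (weyl ψ e)ᴴ * weyl ψ e = 1 := by
  ext y x
  simp only [Matrix.mul_apply, Matrix.conjTranspose_apply, weyl_apply, Matrix.one_apply, mul_ite,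
    mul_zero, Finset.sum_ite_eq', Finset.mem_univ, if_true, add_left_inj]
  by_cases h : x = y
  · subst h
    rw [if_pos rfl, if_pos rfl, Complex.star_def, ← AddChar.map_neg_eq_conj,
      ← AddChar.map_add_eq_mul, neg_add_cancel, AddChar.map_zero_eq_one]
  · rw [if_neg h, if_neg (Ne.symm h), star_zero, zero_mul]

theorem star_weyl_dotProduct (e : (ι → F) × (ι → F)) (u v : (ι → F) → ℂ) :
    star (weyl ψ e *ᵥ u) ⬝ᵥ (weyl ψ e *ᵥ v) = star u ⬝ᵥ v := by
  rw [Matrix.star_mulVec, ← Matrix.dotProduct_mulVec, Matrix.mulVec_mulVec,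
    conjTranspose_weyl_mul, Matrix.one_mulVec]

theorem trace_weyl_zero : (weyl ψ (0 : (ι → F) × (ι → F))).trace = Fintype.card (ι → F) := by
  rw [weyl_zero, Matrix.trace_one]

variable {ψ}

/-- The diagonal is zero if `e.1 ≠ 0`; otherwise the trace sums a non-trivial character over `ι →
F`. -/
theorem trace_weyl (hψ : ψ.IsPrimitive) {e : (ι → F) × (ι → F)} (he : e ≠ 0) :
    (weyl ψ e).trace = 0 := by
  simp only [Matrix.trace, Matrix.diag_apply, weyl_apply, left_eq_add]
  by_cases ha : e.1 = 0
  · simp only [ha, if_true]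
    have hb : e.2 ≠ 0 := fun hb => he (Prod.ext ha hb)
    obtain ⟨i, hi⟩ := Function.ne_iff.1 hb
    let φ : AddChar (ι → F) ℂ :=
      ψ.compAddMonoidHom (AddMonoidHom.mk' (fun x => e.2 ⬝ᵥ x) (dotProduct_add e.2))
    refine AddChar.sum_eq_zero_of_ne_one (ψ := φ) fun h1 => hψ hi ?_
    ext t
    have := DFunLike.congr_fun h1 (Pi.single i t)
    simpa [φ] using this
  · simp [ha]

/-! ### Joint eigenspaces of Weyl operators: existence, dimension and detection of errors. -/

variable (ψ)

/-- The joint eigenspace of the operators `weyl ψ s`, `s ∈ S`, with eigenvalues `χ s`. -/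
def stabilizerCode (S : Submodule F ((ι → F) × (ι → F))) (χ : (ι → F) × (ι → F) → ℂ) :
    Submodule ℂ ((ι → F) → ℂ) where
  carrier := {v | ∀ s ∈ S, weyl ψ s *ᵥ v = χ s • v}
  add_mem' hu hv s hs := by rw [Matrix.mulVec_add, hu s hs, hv s hs, smul_add]
  zero_mem' s _ := by rw [Matrix.mulVec_zero, smul_zero]
  smul_mem' c v hv s hs := by rw [Matrix.mulVec_smul, hv s hs, smul_comm]

variable {ψ} {S : Submodule F ((ι → F) × (ι → F))} {χ : (ι → F) × (ι → F) → ℂ}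
  {v₀ : (ι → F) → ℂ}

theorem exists_stabilizerCode_ne_zero
    (hS : ∀ s ∈ S, ∀ t ∈ S, symplecticForm F ι s t = 0) :
    ∃ χ : (ι → F) × (ι → F) → ℂ, ∃ v ∈ stabilizerCode ψ S χ, v ≠ 0 := by
  classical
  obtain ⟨v, hv0, χ, hχ⟩ := exists_joint_eigenvector
    (fun s : S => Matrix.toLin' (weyl ψ (s : (ι → F) × (ι → F)))) (fun s t => by
      rw [commute_iff_eq, Module.End.mul_eq_comp, Module.End.mul_eq_comp, ← Matrix.toLin'_mul,
        ← Matrix.toLin'_mul, weyl_mul_comm, hS s s.2 t t.2, AddChar.map_zero_eq_one, one_smul])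
  refine ⟨fun s => if h : s ∈ S then χ ⟨s, h⟩ else 0, v, fun s hs => ?_, hv0⟩
  simp only [dif_pos hs]
  exact hχ ⟨s, hs⟩

theorem star_mul_stabilizer_eigenvalue (hv : v₀ ∈ stabilizerCode ψ S χ) (hv0 : v₀ ≠ 0)
    {s : (ι → F) × (ι → F)} (hs : s ∈ S) : star (χ s) * χ s = 1 := by
  have h := star_weyl_dotProduct ψ s v₀ v₀
  rw [hv s hs, star_smul, smul_dotProduct, dotProduct_smul, smul_smul, smul_eq_mul] at h
  exact mul_right_cancel₀ (mt complex_star_dotProduct_self_eq_zero.1 hv0) (h.trans (one_mul _).symm)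

theorem stabilizer_eigenvalue_ne_zero (hv : v₀ ∈ stabilizerCode ψ S χ) (hv0 : v₀ ≠ 0)
    {s : (ι → F) × (ι → F)} (hs : s ∈ S) : χ s ≠ 0 := fun h => by
  simpa [h] using star_mul_stabilizer_eigenvalue hv hv0 hs

theorem stabilizer_eigenvalue_zero (hv : v₀ ∈ stabilizerCode ψ S χ) (hv0 : v₀ ≠ 0) :
    χ 0 = 1 := by
  have h := hv 0 S.zero_mem
  rw [weyl_zero, Matrix.one_mulVec] at h
  exact smul_left_injective ℂ hv0 (by simpa using h.symm)

/-- The operators `weyl ψ s` multiply only up to phase, so `χ` is a character twisted by this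
cocycle. No choice of phases is needed, in characteristic 2 either. -/
theorem stabilizer_eigenvalue_mul (hv : v₀ ∈ stabilizerCode ψ S χ) (hv0 : v₀ ≠ 0)
    {s t : (ι → F) × (ι → F)} (hs : s ∈ S) (ht : t ∈ S) :
    χ s * χ t = ψ (s.2 ⬝ᵥ t.1) * χ (s + t) := by
  have h : weyl ψ s *ᵥ (weyl ψ t *ᵥ v₀) = ψ (s.2 ⬝ᵥ t.1) • weyl ψ (s + t) *ᵥ v₀ := by
    rw [Matrix.mulVec_mulVec, weyl_mul, Matrix.smul_mulVec]
  rw [hv t ht, Matrix.mulVec_smul, hv s hs, hv _ (S.add_mem hs ht), smul_smul, smul_smul] at h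
  rw [mul_comm]
  exact smul_left_injective ℂ hv0 h

theorem star_dotProduct_weyl_of_ne_zero (hψ : ψ.IsPrimitive) (hv : v₀ ∈ stabilizerCode ψ S χ)
    (hv0 : v₀ ≠ 0) {e s : (ι → F) × (ι → F)} (hs : s ∈ S) (he : symplecticForm F ι s e ≠ 0)
    {u v : (ι → F) → ℂ} (hu : u ∈ stabilizerCode ψ S χ) (hv' : v ∈ stabilizerCode ψ S χ) :
    star u ⬝ᵥ (weyl ψ e *ᵥ v) = 0 := by
  -- A non-zero symplectic product may still have trivial phase under `ψ`; since `S` is closed under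
  -- `F`-scalars, `s` can be rescaled until the phase is visible.
  obtain ⟨t, ht⟩ : ∃ t, ψ (symplecticForm F ι s e * t) ≠ 1 := by
    by_contra! h
    exact hψ he (DFunLike.ext _ _ h)
  have hts : t • s ∈ S := S.smul_mem t hs
  have hform : symplecticForm F ι (t • s) e = symplecticForm F ι s e * t := by
    rw [map_smul, LinearMap.smul_apply, smul_eq_mul, mul_comm]
  have h := star_weyl_dotProduct ψ (t • s) u (weyl ψ e *ᵥ v)
  rw [Matrix.mulVec_mulVec, weyl_mul_comm, hform, Matrix.smul_mulVec, ← Matrix.mulVec_mulVec,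
    hv' _ hts, hu _ hts, Matrix.mulVec_smul, star_smul, smul_dotProduct, dotProduct_smul,
    dotProduct_smul] at h
  simp only [smul_eq_mul] at h
  have h1 := star_mul_stabilizer_eigenvalue hv hv0 hts
  have h2 : (ψ (symplecticForm F ι s e * t) - 1) * (star u ⬝ᵥ (weyl ψ e *ᵥ v)) = 0 := by
    linear_combination h - ψ (symplecticForm F ι s e * t) * (star u ⬝ᵥ (weyl ψ e *ᵥ v)) * h1
  exact (mul_eq_zero.1 h2).resolve_left (sub_ne_zero.2 ht)

/-- The projection onto a stabilizer code. -/
def stabilizerProj (ψ : AddChar F ℂ) (S : Submodule F ((ι → F) × (ι → F))) [Fintype S]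
    (χ : (ι → F) × (ι → F) → ℂ) : Matrix (ι → F) (ι → F) ℂ :=
  (Fintype.card S : ℂ)⁻¹ • ∑ s : S, (χ s)⁻¹ • weyl ψ (s : (ι → F) × (ι → F))

variable [Fintype S]

theorem isProj_stabilizerProj (hv : v₀ ∈ stabilizerCode ψ S χ) (hv0 : v₀ ≠ 0) :
    LinearMap.IsProj (stabilizerCode ψ S χ) (Matrix.toLin' (stabilizerProj ψ S χ)) := by
  constructor
  · intro x t ht
    have h : weyl ψ t * stabilizerProj ψ S χ = χ t • stabilizerProj ψ S χ := by
      rw [stabilizerProj, Matrix.mul_smul, smul_comm (χ t), Finset.mul_sum,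
        Finset.smul_sum (r := χ t)]
      congr 1
      -- Translation by `t` permutes `S`, and the phase from `weyl_mul` cancels the cocycle of `χ`.
      refine Fintype.sum_equiv (Equiv.addLeft (⟨t, ht⟩ : S)) _ _ fun s => ?_
      rw [Matrix.mul_smul, weyl_mul, smul_smul, smul_smul]
      congr 1
      have h1 := stabilizer_eigenvalue_mul hv hv0 ht s.2
      have h2 := stabilizer_eigenvalue_ne_zero hv hv0 s.2
      have h3 := stabilizer_eigenvalue_ne_zero hv hv0 (S.add_mem ht s.2)
      rw [Equiv.coe_addLeft, Submodule.coe_add]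
      field_simp
      rw [← h1]; ring
    rw [Matrix.toLin'_apply, Matrix.mulVec_mulVec, h, Matrix.smul_mulVec]
  · intro x hx
    rw [Matrix.toLin'_apply, stabilizerProj, Matrix.smul_mulVec, Matrix.sum_mulVec]
    have : ∀ s : S, ((χ s)⁻¹ • weyl ψ (s : (ι → F) × (ι → F))) *ᵥ x = x := fun s => by
      rw [Matrix.smul_mulVec, hx s s.2, smul_smul,
        inv_mul_cancel₀ (stabilizer_eigenvalue_ne_zero hv hv0 s.2), one_smul]
    simp only [this, Finset.sum_const, Finset.card_univ]
    rw [← Nat.cast_smul_eq_nsmul ℂ, smul_smul, inv_mul_cancel₀ (by simp), one_smul]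

theorem trace_weyl_mul_stabilizerProj (hψ : ψ.IsPrimitive) {e : (ι → F) × (ι → F)} (he : e ∉ S) :
    (weyl ψ e * stabilizerProj ψ S χ).trace = 0 := by
  rw [stabilizerProj, Matrix.mul_smul, Matrix.trace_smul, Finset.mul_sum, Matrix.trace_sum,
    Finset.sum_eq_zero, smul_zero]
  intro s _
  rw [Matrix.mul_smul, weyl_mul, Matrix.trace_smul, Matrix.trace_smul, trace_weyl hψ, smul_zero,
    smul_zero]
  intro h
  rw [eq_neg_of_add_eq_zero_left h] at he
  exact he (S.neg_mem s.2)

theorem trace_stabilizerProj (hψ : ψ.IsPrimitive) (hv : v₀ ∈ stabilizerCode ψ S χ)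
    (hv0 : v₀ ≠ 0) :
    (stabilizerProj ψ S χ).trace = (Fintype.card S : ℂ)⁻¹ * Fintype.card (ι → F) := by
  rw [stabilizerProj, Matrix.trace_smul, Matrix.trace_sum, smul_eq_mul,
    Finset.sum_eq_single (0 : S)]
  · rw [Submodule.coe_zero, stabilizer_eigenvalue_zero hv hv0, inv_one, one_smul, trace_weyl_zero]
  · intro s _ hs
    rw [Matrix.trace_smul, trace_weyl hψ (by simpa using hs), smul_zero]
  · simp

/-- The dimension is the trace of the projection, to which only the term `s = 0` contributes. -/
theorem finrank_stabilizerCode (hψ : ψ.IsPrimitive) (hv : v₀ ∈ stabilizerCode ψ S χ)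
    (hv0 : v₀ ≠ 0) :
    Module.finrank ℂ (stabilizerCode ψ S χ) * Fintype.card S = Fintype.card (ι → F) := by
  have h := (isProj_stabilizerProj hv hv0).trace
  rw [Matrix.trace_toLin'_eq, trace_stabilizerProj hψ hv hv0] at h
  have h0 : (Fintype.card S : ℂ) ≠ 0 := by simp
  have : (Module.finrank ℂ (stabilizerCode ψ S χ) : ℂ) * Fintype.card S = Fintype.card (ι → F) := by
    rw [← h]; field_simp
  exact_mod_cast this

/-- The operator commutes with those of `S`, so it preserves the code, and detection would make it a
scalar `c` there. Comparing traces against the projection gives `c = 0`, contrary to unitarity. -/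
theorem not_detects_weyl (hψ : ψ.IsPrimitive) (hv : v₀ ∈ stabilizerCode ψ S χ) (hv0 : v₀ ≠ 0)
    {e : (ι → F) × (ι → F)} (heS : e ∉ S) (he : ∀ s ∈ S, symplecticForm F ι s e = 0) :
    ¬ Detects (stabilizerCode ψ S χ) (weyl ψ e) := by
  rintro ⟨c, hc⟩
  have hmem : ∀ v ∈ stabilizerCode ψ S χ, weyl ψ e *ᵥ v ∈ stabilizerCode ψ S χ := by
    intro v hv s hs
    rw [Matrix.mulVec_mulVec, weyl_mul_comm, he s hs, AddChar.map_zero_eq_one, one_smul,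
      ← Matrix.mulVec_mulVec, hv s hs, Matrix.mulVec_smul]
  have hscal : ∀ v ∈ stabilizerCode ψ S χ, weyl ψ e *ᵥ v = c • v := by
    intro v hv
    have hm : weyl ψ e *ᵥ v - c • v ∈ stabilizerCode ψ S χ :=
      Submodule.sub_mem _ (hmem v hv) (Submodule.smul_mem _ c hv)
    refine sub_eq_zero.1 (complex_star_dotProduct_self_eq_zero.1 ?_)
    rw [dotProduct_sub, hc _ hm v hv, dotProduct_smul, smul_eq_mul, sub_self]
  have hP := isProj_stabilizerProj hv hv0
  have hmul : weyl ψ e * stabilizerProj ψ S χ = c • stabilizerProj ψ S χ := by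
    refine Matrix.toLin'.injective (LinearMap.ext fun x => ?_)
    rw [Matrix.toLin'_mul, LinearMap.comp_apply, map_smul, LinearMap.smul_apply,
      Matrix.toLin'_apply (weyl ψ e)]
    exact hscal _ (hP.map_mem x)
  have htr := congrArg Matrix.trace hmul
  rw [trace_weyl_mul_stabilizerProj hψ heS, Matrix.trace_smul, trace_stabilizerProj hψ hv hv0] at htr
  have hc0 : c = 0 := by simpa using htr.symm
  have := star_weyl_dotProduct ψ e v₀ v₀
  rw [hscal v₀ hv, hc0, zero_smul, star_zero, zero_dotProduct] at this
  exact hv0 (complex_star_dotProduct_self_eq_zero.1 this.symm)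

end Weyl

end QMDS

end

noncomputable section

namespace QMDS

/-! ### Pauli errors -/

section Pauli

variable (p : ℕ) [Fact p.Prime] (F : Type*) [Field F] [Algebra (ZMod p) F]

/-- The additive character `x ↦ exp (2πi tr(x) / p)`. -/
def traceChar : AddChar F ℂ :=
  ZMod.stdAddChar.compAddMonoidHom (Algebra.trace (ZMod p) F).toAddMonoidHom

theorem traceChar_apply (x : F) :
    traceChar p F x = ZMod.stdAddChar (Algebra.trace (ZMod p) F x) := rfl

variable [Fintype F]

theorem traceChar_isPrimitive : (traceChar p F).IsPrimitive := by
  intro a ha h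
  refine ha ((traceForm_nondegenerate (ZMod p) F).1 a fun b => ?_)
  have hb := DFunLike.congr_fun h b
  rw [AddChar.mulShift_apply, traceChar_apply, AddChar.one_apply,
    ← AddChar.map_zero_eq_one (ZMod.stdAddChar (N := p))] at hb
  exact ZMod.injective_stdAddChar (N := p) hb

variable {F} [DecidableEq F] {n : ℕ}

theorem pauliX_mul_pauliZ_apply (a b y x : F) :
    (pauliX a * pauliZ p b) y x = if y = x + a then traceChar p F (b * x) else 0 := by
  rw [pauliZ, Matrix.mul_diagonal, pauliX, Matrix.of_apply, ite_mul, one_mul, zero_mul]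
  rfl

theorem pauliX_mul_pauliZ_eq_one_iff {a b : F} :
    pauliX a * pauliZ p b = 1 ↔ a = 0 ∧ b = 0 := by
  constructor
  · intro h
    have h1 : ∀ y x, (if y = x + a then traceChar p F (b * x) else 0) =
        (1 : Matrix F F ℂ) y x := fun y x => by rw [← h, pauliX_mul_pauliZ_apply]
    have ha : a = 0 := by
      have := h1 0 0
      by_contra ha
      rw [if_neg (by simpa using Ne.symm ha)] at this
      simp at this
    subst ha
    refine ⟨rfl, ?_⟩
    by_contra hb
    refine traceChar_isPrimitive p F hb (DFunLike.ext _ _ fun x => ?_)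
    simpa using h1 x x
  · rintro ⟨rfl, rfl⟩
    ext y x
    rw [pauliX_mul_pauliZ_apply]
    simp [Matrix.one_apply]

/-- The components of the Pauli error `X(a) Z(b)`, `e = (a, b)`. -/
def pauliError (e : (Fin n → F) × (Fin n → F)) (i : Fin n) : Matrix F F ℂ :=
  pauliX (e.1 i) * pauliZ p (e.2 i)

theorem tensorOp_pauliError (e : (Fin n → F) × (Fin n → F)) :
    tensorOp (pauliError p e) = weyl (traceChar p F) e := by
  ext y x
  simp only [tensorOp, pauliError, Matrix.of_apply, pauliX_mul_pauliZ_apply, weyl_apply]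
  by_cases h : y = x + e.1
  · rw [if_pos h]
    exact (Finset.prod_congr rfl fun i _ => if_pos (congrFun h i)).trans
      (map_prod (traceChar p F).toMonoidHom
        (fun i => Multiplicative.ofAdd (e.2 i * x i)) Finset.univ).symm
  · rw [if_neg h]
    obtain ⟨i, hi⟩ := Function.ne_iff.1 h
    exact Finset.prod_eq_zero (Finset.mem_univ i) (if_neg hi)

theorem weight_pauliError (e : (Fin n → F) × (Fin n → F)) :
    weight (pauliError p e) = hammingNorm fun i => (e.1 i, e.2 i) := by
  have : {i | pauliError p e i ≠ 1} =
      ((Finset.univ.filter fun i => (e.1 i, e.2 i) ≠ 0 : Finset (Fin n)) : Set (Fin n)) := by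
    ext i
    simp [pauliError, pauliX_mul_pauliZ_eq_one_iff, Prod.ext_iff]
  rw [weight, this, Set.ncard_coe_finset]
  rfl

theorem exists_eq_pauliError {E : Fin n → Matrix F F ℂ} (hE : ∀ i, IsPauli p (E i)) :
    ∃ e, E = pauliError p e := by
  choose a b h using hE
  exact ⟨(a, b), funext h⟩

theorem isPauli_pauliError (e : (Fin n → F) × (Fin n → F)) (i : Fin n) :
    IsPauli p (pauliError p e i) := ⟨_, _, rfl⟩

/-- The stabilizer code of the symplectic dual of a code `T` that contains its symplectic dual. -/
theorem exists_isQuantumCode {T : Submodule F ((Fin n → F) × (Fin n → F))}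
    (hT : (symplecticForm F (Fin n)).orthogonal T ≤ T) {m d : ℕ}
    (hm : Module.finrank F T = n + m)
    (hd : ∀ e ∈ T, e ≠ 0 → d ≤ hammingNorm fun i => (e.1 i, e.2 i))
    {e₀ : (Fin n → F) × (Fin n → F)} (he₀ : e₀ ∈ T) (he₀0 : e₀ ≠ 0)
    (he₀d : (hammingNorm fun i => (e₀.1 i, e₀.2 i)) = d)
    (hmem : m = 0 ∨ e₀ ∉ (symplecticForm F (Fin n)).orthogonal T) :
    ∃ Q : Submodule ℂ ((Fin n → F) → ℂ), IsQuantumCode p n m d Q := by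
  classical
  set S := (symplecticForm F (Fin n)).orthogonal T with hSdef
  have hST : (symplecticForm F (Fin n)).orthogonal S = T :=
    LinearMap.BilinForm.orthogonal_orthogonal symplecticForm_nondegenerate
      symplecticForm_isRefl T
  have hmemT : ∀ e, e ∈ T ↔ ∀ s ∈ S, symplecticForm F (Fin n) s e = 0 := fun e => by
    conv_lhs => rw [← hST]
    exact LinearMap.BilinForm.mem_orthogonal_iff
  have hV : Module.finrank F ((Fin n → F) × (Fin n → F)) = n + n := by simp
  have hS : Module.finrank F S = n - m := by
    rw [hSdef, LinearMap.BilinForm.finrank_orthogonal symplecticForm_nondegenerate, hm, hV]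
    omega
  have hmn : m ≤ n := by
    have := Submodule.finrank_le T
    omega
  have hψ := traceChar_isPrimitive p F
  obtain ⟨χ, v₀, hv, hv0⟩ := exists_stabilizerCode_ne_zero (ψ := traceChar p F) (S := S)
    fun s hs t ht => (hmemT t).1 (hT ht) s hs
  have hrank : Module.finrank ℂ (stabilizerCode (traceChar p F) S χ) = Fintype.card F ^ m := by
    have h := finrank_stabilizerCode hψ hv hv0
    rw [Module.card_eq_pow_finrank (K := F) (V := S), hS, Fintype.card_fun, Fintype.card_fin] at h
    have hq : 0 < Fintype.card F ^ (n - m) := pow_pos Fintype.card_pos _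
    refine Nat.eq_of_mul_eq_mul_right hq (h.trans ?_)
    rw [← pow_add]
    congr 1
    omega
  refine ⟨stabilizerCode (traceChar p F) S χ, hrank, ?_, ?_⟩
  · refine ⟨pauliError p e₀, isPauli_pauliError p e₀, (weight_pauliError p e₀).trans he₀d, ?_⟩
    -- An error in `S` acts as a non-zero scalar and so is detected; it counts only by the
    -- convention for one-dimensional codes, and here `m = 0`.
    by_cases he : e₀ ∈ S
    · right
      refine ⟨?_, ?_, v₀, hv, ?_⟩
      · rw [hrank, hmem.resolve_right (not_not_intro he), pow_zero]
      · rw [weight_pauliError, Ne, hammingNorm_eq_zero]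
        refine fun h => he₀0 (Prod.ext (funext fun i => ?_) (funext fun i => ?_))
        · exact congrArg Prod.fst (congrFun h i)
        · exact congrArg Prod.snd (congrFun h i)
      · rw [tensorOp_pauliError, hv e₀ he, dotProduct_smul, smul_eq_mul]
        exact mul_ne_zero (stabilizer_eigenvalue_ne_zero hv hv0 he)
          (mt complex_star_dotProduct_self_eq_zero.1 hv0)
    · left
      rw [tensorOp_pauliError]
      exact not_detects_weyl hψ hv hv0 he ((hmemT e₀).1 he₀)
  · rintro w ⟨E, hE, rfl, hconf⟩
    obtain ⟨e, rfl⟩ := exists_eq_pauliError p hE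
    rw [weight_pauliError]
    by_cases heT : e ∈ T
    · by_cases he0 : e = 0
      · exfalso
        rcases hconf with h | ⟨-, h, -⟩
        · refine h ⟨1, fun u _ v _ => ?_⟩
          rw [tensorOp_pauliError, he0, weyl_zero, Matrix.one_mulVec, one_mul]
        · rw [weight_pauliError, he0] at h
          exact h (hammingNorm_eq_zero.2 rfl)
      · exact hd e heT he0
    -- Some `s ∈ S` fails to be orthogonal to `e`, so the error maps the code into its orthogonal
    -- complement.
    · exfalso
      rw [hmemT] at heT
      push Not at heT
      obtain ⟨s, hs, hse⟩ := heT
      have hzero : ∀ u ∈ stabilizerCode (traceChar p F) S χ,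
          ∀ v ∈ stabilizerCode (traceChar p F) S χ,
          star u ⬝ᵥ (weyl (traceChar p F) e *ᵥ v) = 0 := fun u hu v hv' =>
        star_dotProduct_weyl_of_ne_zero hψ hv hv0 hs hse hu hv'
      rcases hconf with h | ⟨-, -, u, hu, h⟩
      · refine h ⟨0, fun u hu v hv' => ?_⟩
        rw [tensorOp_pauliError, hzero u hu v hv', zero_mul]
      · rw [tensorOp_pauliError] at h
        exact h (hzero u hu u hu)

end Pauli

/-! ### Quadratic extensions -/

section Quadratic

/-- Only cardinalities relate `K` to `F`: they force equal characteristics and divisibility of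
degrees over the prime field, hence an embedding. -/
theorem nonempty_ringHom_of_card_eq_sq {F K : Type*} [Field F] [Fintype F] [Field K] [Fintype K]
    (h : Fintype.card K = Fintype.card F ^ 2) : Nonempty (F →+* K) := by
  obtain ⟨p, hp⟩ := CharP.exists F
  obtain ⟨p', hp'⟩ := CharP.exists K
  obtain ⟨m, hpp, hm⟩ := FiniteField.card F p
  obtain ⟨m', hpp', hm'⟩ := FiniteField.card K p'
  have hpe : p' = p := by
    rw [hm, hm', ← pow_mul] at h
    refine (Nat.prime_dvd_prime_iff_eq hpp' hpp).1 (hpp'.dvd_of_dvd_pow (n := m * 2) ?_)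
    rw [← h]
    exact dvd_pow_self _ m'.pos.ne'
  subst hpe
  have : Fact p'.Prime := ⟨hpp⟩
  let := ZMod.algebra F p'
  let := ZMod.algebra K p'
  have hF := FiniteField.pow_finrank_eq_card p' F
  have hK := FiniteField.pow_finrank_eq_card p' K
  have : Module.finrank (ZMod p') K = Module.finrank (ZMod p') F * 2 := by
    refine Nat.pow_right_injective hpp.two_le ?_
    simp only
    rw [hK, h, ← hF, pow_mul]
  obtain ⟨f⟩ := FiniteField.nonempty_algHom_of_finrank_dvd (F := ZMod p') (K := F) (L := K)
    ⟨2, this⟩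
  exact ⟨f.toRingHom⟩

variable {F K ι : Type*} [Field F] [Fintype F] [Field K] [Algebra F K]

theorem finrank_eq_two [Fintype K] (h : Fintype.card K = Fintype.card F ^ 2) : Module.finrank F K = 2 :=
  Nat.pow_right_injective (Fintype.one_lt_card (α := F))
    (by simp only; rw [← h, Module.card_eq_pow_finrank (K := F) (V := K)])

theorem exists_pow_card_ne [Fintype K] (h : Fintype.card K = Fintype.card F ^ 2) :
    ∃ β : K, β ^ Fintype.card F ≠ β := by
  by_contra! hβ
  have h1 : FiniteField.frobeniusAlgHom F K = 1 := AlgHom.ext hβ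
  have h2 := FiniteField.orderOf_frobeniusAlgHom F K
  rw [h1, orderOf_one, finrank_eq_two h] at h2
  omega

variable {β : K}

theorem add_mul_eq_zero_iff (hβ : β ^ Fintype.card F ≠ β) {a b : F} :
    algebraMap F K a + algebraMap F K b * β = 0 ↔ a = 0 ∧ b = 0 := by
  constructor
  · intro h
    have h1 := congrArg (FiniteField.frobeniusAlgHom F K) h
    rw [map_add, map_mul, map_zero, AlgHom.commutes, AlgHom.commutes,
      FiniteField.coe_frobeniusAlgHom] at h1
    have h2 : algebraMap F K b * (β ^ Fintype.card F - β) = 0 := by linear_combination h1 - h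
    have hb : b = 0 := by
      simpa using (mul_eq_zero.1 h2).resolve_right (sub_ne_zero.2 hβ)
    subst hb
    exact ⟨by simpa using h, rfl⟩
  · rintro ⟨rfl, rfl⟩
    simp

/-- The map `(a, b) ↦ a + b β`. -/
def combine (F ι : Type*) [Field F] [Fintype F] [Algebra F K] (β : K) :
    (ι → F) × (ι → F) →ₗ[F] (ι → K) where
  toFun e i := algebraMap F K (e.1 i) + algebraMap F K (e.2 i) * β
  map_add' e e' := by
    ext i
    simp only [Prod.fst_add, Prod.snd_add, Pi.add_apply, map_add]
    ring
  map_smul' c e := by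
    ext i
    simp only [Prod.smul_fst, Prod.smul_snd, Pi.smul_apply, smul_eq_mul, map_mul,
      RingHom.id_apply]
    rw [Algebra.smul_def]
    ring

theorem combine_apply (e : (ι → F) × (ι → F)) (i : ι) :
    combine F ι β e i = algebraMap F K (e.1 i) + algebraMap F K (e.2 i) * β := rfl

theorem combine_injective (hβ : β ^ Fintype.card F ≠ β) :
    Function.Injective (combine F ι β) := by
  rw [← LinearMap.ker_eq_bot, LinearMap.ker_eq_bot']
  intro e he
  exact Prod.ext (funext fun i => ((add_mul_eq_zero_iff hβ).1 (congrFun he i)).1)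
    (funext fun i => ((add_mul_eq_zero_iff hβ).1 (congrFun he i)).2)

variable [Fintype ι]

theorem hammingNorm_combine [DecidableEq F] [DecidableEq K] (hβ : β ^ Fintype.card F ≠ β)
    (e : (ι → F) × (ι → F)) :
    hammingNorm (combine F ι β e) = hammingNorm fun i => (e.1 i, e.2 i) := by
  unfold hammingNorm
  congr 1
  ext i
  simp only [Finset.mem_filter, Finset.mem_univ, true_and]
  rw [combine_apply, Ne, add_mul_eq_zero_iff hβ, Ne, Prod.mk_eq_zero]

/-- Links the two forms: the products `a a'` and `b b' β ^ (q + 1)` are symmetric and cancel,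
leaving the symplectic part. -/
theorem hermitianForm_combine_sub (e e' : (ι → F) × (ι → F)) :
    hermitianForm (Fintype.card F) (combine F ι β e) (combine F ι β e') -
      hermitianForm (Fintype.card F) (combine F ι β e') (combine F ι β e) =
      (β - β ^ Fintype.card F) * algebraMap F K (symplecticForm F ι e e') := by
  have hpow : ∀ (e : (ι → F) × (ι → F)) i, combine F ι β e i ^ Fintype.card F =
      algebraMap F K (e.1 i) + algebraMap F K (e.2 i) * β ^ Fintype.card F := by
    intro e i
    have := map_add (FiniteField.frobeniusAlgHom F K) (algebraMap F K (e.1 i))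
      (algebraMap F K (e.2 i) * β)
    rwa [map_mul, AlgHom.commutes, AlgHom.commutes, FiniteField.coe_frobeniusAlgHom] at this
  simp only [hermitianForm, hpow]
  simp only [combine_apply, symplecticForm_apply, dotProduct, map_sub, map_sum,
    map_mul, Finset.mul_sum, ← Finset.sum_sub_distrib]
  exact Finset.sum_congr rfl fun i _ => by ring

theorem hermitianForm_pow [Fintype K] (h : Fintype.card K = Fintype.card F ^ 2) (u v : ι → K) :
    hermitianForm (Fintype.card F) u v ^ Fintype.card F = hermitianForm (Fintype.card F) v u := by
  have := map_sum (FiniteField.frobeniusAlgHom F K) (fun i => u i * v i ^ Fintype.card F)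
    Finset.univ
  rw [FiniteField.coe_frobeniusAlgHom] at this
  refine this.trans (Finset.sum_congr rfl fun i _ => ?_)
  simp only
  rw [mul_pow, ← pow_mul, ← sq, ← h, FiniteField.pow_card, mul_comm]

theorem hermitianForm_smul_left (q : ℕ) (c : K) (u v : ι → K) :
    hermitianForm q (c • u) v = c * hermitianForm q u v := by
  simp only [hermitianForm, Pi.smul_apply, smul_eq_mul, Finset.mul_sum, mul_assoc]

/-- The symplectic dual of the expansion of a `K`-linear code lies in its Hermitian dual. -/
theorem combine_mem_hermitianDual [Fintype K] (h : Fintype.card K = Fintype.card F ^ 2)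
    (hβ : β ^ Fintype.card F ≠ β) (hsurj : Function.Surjective (combine F ι β))
    {D : Submodule K (ι → K)} {w : (ι → F) × (ι → F)}
    (hw : w ∈ (symplecticForm F ι).orthogonal ((D.restrictScalars F).comap (combine F ι β))) :
    combine F ι β w ∈ hermitianDual (Fintype.card F) D := by
  have key : ∀ u ∈ D, hermitianForm (Fintype.card F) u (combine F ι β w) =
      hermitianForm (Fintype.card F) u (combine F ι β w) ^ Fintype.card F := by
    intro u hu
    obtain ⟨e, rfl⟩ := hsurj u
    have h1 := hermitianForm_combine_sub (β := β) e w
    rw [LinearMap.BilinForm.mem_orthogonal_iff] at hw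
    have h2 : symplecticForm F ι e w = 0 := hw e hu
    rw [h2, map_zero, mul_zero] at h1
    rw [hermitianForm_pow h]
    exact sub_eq_zero.1 h1
  intro u hu
  have h1 := key u hu
  -- Symplectic orthogonality alone makes the Hermitian product Frobenius-invariant. By
  -- `K`-linearity of `D` its multiple by `β` is invariant too, and `β` is not.
  have h2 := key (β • u) (D.smul_mem β hu)
  rw [hermitianForm_smul_left, mul_pow, ← h1] at h2
  have h3 : (β ^ Fintype.card F - β) * hermitianForm (Fintype.card F) u (combine F ι β w) = 0 := by
    linear_combination -h2
  exact (mul_eq_zero.1 h3).resolve_left (sub_ne_zero.2 hβ)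

theorem combine_bijective [Fintype K] (h : Fintype.card K = Fintype.card F ^ 2)
    (hβ : β ^ Fintype.card F ≠ β) : Function.Bijective (combine F ι β) := by
  classical
  rw [Fintype.bijective_iff_injective_and_card]
  refine ⟨combine_injective hβ, ?_⟩
  rw [Fintype.card_prod, Fintype.card_fun, Fintype.card_fun, h, ← pow_mul, ← pow_add, two_mul]

theorem finrank_comap_combine [Fintype K] (h : Fintype.card K = Fintype.card F ^ 2)
    (hβ : β ^ Fintype.card F ≠ β) (D : Submodule K (ι → K)) :
    Module.finrank F ((D.restrictScalars F).comap (combine F ι β)) = 2 * Module.finrank K D := by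
  let L := LinearEquiv.ofBijective (combine F ι β) (combine_bijective h hβ)
  have h1 : (D.restrictScalars F).comap (combine F ι β) =
      (D.restrictScalars F).map (L.symm : (ι → K) →ₗ[F] (ι → F) × (ι → F)) :=
    Submodule.comap_equiv_eq_map_symm L _
  rw [h1, LinearEquiv.finrank_map_eq, ← finrank_eq_two h]
  exact (Module.finrank_mul_finrank F K D).symm

end Quadratic

/-! ### Puncturing a self-dual code -/

section Puncture

theorem hammingNorm_add_card_le {A ι κ : Type*} [Zero A] [DecidableEq A] [Fintype ι] [Fintype κ]
    {g : ι → κ} (hg : g.Injective) (v : κ → A) :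
    hammingNorm v + Fintype.card ι ≤ hammingNorm (v ∘ g) + Fintype.card κ := by
  classical
  have h1 : (Finset.univ.filter fun i => v i ≠ 0) ⊆
      (Finset.univ.filter fun i => (v ∘ g) i ≠ 0).image g ∪ (Finset.univ.image g)ᶜ := by
    intro j hj
    by_cases h : j ∈ Finset.univ.image g
    · obtain ⟨i, -, rfl⟩ := Finset.mem_image.1 h
      refine Finset.mem_union_left _ (Finset.mem_image_of_mem g ?_)
      simpa using hj
    · exact Finset.mem_union_right _ (Finset.mem_compl.2 h)
  have h2 := (Finset.card_le_card h1).trans (Finset.card_union_le _ _)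
  rw [Finset.card_compl, Finset.card_image_of_injective _ hg, Finset.card_image_of_injective _ hg,
    Finset.card_univ] at h2
  have h3 := Fintype.card_le_of_injective g hg
  change hammingNorm v ≤ hammingNorm (v ∘ g) + _ at h2
  omega

theorem hammingNorm_extend {A ι κ : Type*} [Zero A] [DecidableEq A] [Fintype ι] [Fintype κ]
    {g : ι → κ} (hg : g.Injective) (v : ι → A) :
    hammingNorm (Function.extend g v 0) = hammingNorm v := by
  classical
  unfold hammingNorm
  rw [← Finset.card_image_of_injective _ hg]
  congr 1
  ext j
  simp only [Finset.mem_filter, Finset.mem_univ, true_and, Finset.mem_image]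
  by_cases h : ∃ i, g i = j
  · obtain ⟨i, rfl⟩ := h
    simp [hg.extend_apply, hg.eq_iff]
  · rw [Function.extend_apply' _ _ _ h]
    simp only [Pi.zero_apply, ne_eq, not_true_eq_false, false_iff]
    rintro ⟨i, -, hi⟩
    exact h ⟨i, hi⟩

theorem hermitianForm_extend {K ι κ : Type*} [Field K] [Fintype ι] [Fintype κ] {q : ℕ} (hq : q ≠ 0)
    {g : ι → κ} (hg : g.Injective) (v : κ → K) (w : ι → K) :
    hermitianForm q v (Function.extend g w 0) = hermitianForm q (v ∘ g) w := by
  classical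
  unfold hermitianForm
  rw [← Finset.sum_subset (Finset.subset_univ (Finset.univ.image g)),
    Finset.sum_image hg.injOn]
  · simp [hg.extend_apply]
  · intro j _ hj
    rw [Function.extend_apply' _ _ _ (by simpa using hj), Pi.zero_apply, zero_pow hq, mul_zero]

variable (p : ℕ) [Fact p.Prime] {F K κ : Type*} [Field F] [Fintype F] [DecidableEq F]
  [Algebra (ZMod p) F] [Field K] [Fintype K] [DecidableEq K] [Fintype κ]

theorem exists_isQuantumCode_of_hermitianDual_eq (hcard : Fintype.card K = Fintype.card F ^ 2)
    {C : Submodule K (κ → K)} (hC : hermitianDual (Fintype.card F) C = C) {k r n d : ℕ}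
    (hCk : Module.finrank K C = k) (hκ : Fintype.card κ = 2 * k)
    (hd : ∀ v ∈ C, v ≠ 0 → d + r ≤ hammingNorm v) (hd0 : 0 < d) (hn : n + r = 2 * k)
    {g : Fin n → κ} (hg : g.Injective) {v₀ : κ → K} (hv₀ : v₀ ∈ C) (hv₀0 : v₀ ≠ 0)
    (hv₀d : hammingNorm (v₀ ∘ g) ≤ d) :
    ∃ Q : Submodule ℂ ((Fin n → F) → ℂ), IsQuantumCode p n r d Q := by
  obtain ⟨j⟩ := nonempty_ringHom_of_card_eq_sq hcard
  let := j.toAlgebra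
  obtain ⟨β, hβ⟩ := exists_pow_card_ne hcard
  have hbij : Function.Bijective (combine F (Fin n) β) := combine_bijective hcard hβ
  set f : (κ → K) →ₗ[K] (Fin n → K) := LinearMap.funLeft K K g with hf
  have hfa : ∀ v, f v = v ∘ g := fun v => rfl
  have hle : ∀ v ∈ C, v ≠ 0 → d ≤ hammingNorm (f v) := by
    intro v hv hv0
    have h1 := hammingNorm_add_card_le hg v
    have h2 := hd v hv hv0
    rw [Fintype.card_fin, hκ] at h1
    rw [hfa]
    omega
  have hinj : ∀ v ∈ C, f v = 0 → v = 0 := by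
    intro v hv h0
    by_contra hne
    have := hle v hv hne
    rw [h0, hammingNorm_zero] at this
    omega
  have hrank : Module.finrank K (C.map f) = k := by
    rw [← LinearMap.range_domRestrict, LinearMap.finrank_range_of_inj, hCk]
    rw [← LinearMap.ker_eq_bot, LinearMap.ker_eq_bot']
    exact fun v hv => Subtype.ext (hinj v v.2 hv)
  set T := ((C.map f).restrictScalars F).comap (combine F (Fin n) β) with hT
  -- Duality exchanges puncturing and shortening: a dual word of the punctured code, padded with
  -- zeros, is a word of the self-dual `C`.
  have hext : ∀ w ∈ (symplecticForm F (Fin n)).orthogonal T,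
      Function.extend g (combine F (Fin n) β w) 0 ∈ C := by
    intro w hw
    have h1 := combine_mem_hermitianDual hcard hβ hbij.2 hw
    rw [← SetLike.mem_coe, ← hC]
    intro u hu
    rw [hermitianForm_extend Fintype.card_ne_zero hg]
    exact h1 _ (Submodule.mem_map_of_mem hu)
  obtain ⟨e₀, he₀⟩ := hbij.2 (f v₀)
  have he₀T : e₀ ∈ T := by
    rw [hT, Submodule.mem_comap, he₀]
    exact Submodule.mem_map_of_mem hv₀
  have he₀0 : e₀ ≠ 0 := by
    rintro rfl
    rw [map_zero] at he₀
    exact hv₀0 (hinj v₀ hv₀ he₀.symm)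
  have he₀d : hammingNorm (f v₀) = d := le_antisymm hv₀d (hle v₀ hv₀ hv₀0)
  refine exists_isQuantumCode p (T := T) (m := r) (d := d) (fun w hw => ?_) ?_
    (fun e he he0 => ?_) he₀T he₀0 ?_ ?_
  · refine ⟨_, hext w hw, ?_⟩
    rw [hfa]
    exact funext fun i => hg.extend_apply _ _ i
  · rw [hT, finrank_comap_combine hcard hβ, hrank, ← hn]
  · rw [← hammingNorm_combine hβ]
    obtain ⟨v, hv, hve⟩ := he
    rw [← hve]
    refine hle v hv ?_
    rintro rfl
    rw [map_zero] at hve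
    exact he0 (hbij.1 (hve.symm.trans (map_zero _).symm))
  · rw [← hammingNorm_combine hβ, he₀, he₀d]
  -- If `e₀` were in the symplectic dual, padding it would give a word of `C` of weight `d`, below
  -- the bound `d + r` as `r ≠ 0`.
  · by_contra! hcon
    have h1 := hext e₀ hcon.2
    have h2 := hd _ h1 ?_
    · rw [hammingNorm_extend hg, he₀, he₀d] at h2
      have := hcon.1
      omega
    · intro h0
      rw [← hammingNorm_eq_zero, hammingNorm_extend hg, he₀, he₀d] at h0
      omega

end Puncture

end QMDS

end

/-! ### Conjugation on `K` and assembly of the theorem. -/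

namespace QMDS

theorem exists_ringHom_eq_pow {F K : Type*} [Field F] [Fintype F] [Field K] [Fintype K]
    (h : Fintype.card K = Fintype.card F ^ 2) :
    ∃ σ : K →+* K, ∀ x, σ x = x ^ Fintype.card F := by
  obtain ⟨j⟩ := nonempty_ringHom_of_card_eq_sq h
  let := j.toAlgebra
  exact ⟨(FiniteField.frobeniusAlgHom F K : K →+* K), fun _ => rfl⟩

theorem det_submatrix_map_transpose_ne_zero {K : Type*} [Field K] {k j : ℕ} (σ : K →+* K)
    {M : Matrix (Fin k) (Fin k) K} (hM : ∀ f g : Fin j ↪o Fin k, (M.submatrix f g).det ≠ 0)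
    (f g : Fin j ↪o Fin k) : (((M.map σ)ᵀ).submatrix f g).det ≠ 0 := by
  have h : ((M.map σ)ᵀ).submatrix f g = (σ.mapMatrix (M.submatrix g f))ᵀ := rfl
  rw [h, Matrix.det_transpose, ← RingHom.map_det]
  exact (map_ne_zero σ).2 (hM g f)

end QMDS

theorem mainTheorem3 (p q : ℕ) [Fact p.Prime]
    {F : Type*} [Field F] [Fintype F] [DecidableEq F] [Algebra (ZMod p) F]
    {K : Type*} [Field K] [Fintype K] [DecidableEq K]
    (hF : Fintype.card F = q) (hK : Fintype.card K = q ^ 2)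
    (k : ℕ) (hk : 1 ≤ k) (M : Matrix (Fin k) (Fin k) K) (lam : K) (hlam : lam ≠ 0)
    (hM : IsUnit M.det)
    (hMsigma : (M.map fun x => x ^ q)ᵀ = -(lam ^ (q + 1) • M⁻¹))
    (hminor : ∀ j : ℕ, 1 ≤ j → j ≤ k / 2 →
      ∀ f g : Fin j ↪o Fin k, (M.submatrix f g).det ≠ 0) :
    (QMDS.IsLinearCode (QMDS.doubleCode lam M) (2 * k) k (k + 1) ∧
      QMDS.IsMDS (QMDS.doubleCode lam M : Set (Fin k ⊕ Fin k → K)) ∧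
      QMDS.hermitianDual q (QMDS.doubleCode lam M) = QMDS.doubleCode lam M) ∧
    ∀ r : ℕ, r < k → ∃ Q : Submodule ℂ ((Fin (2 * k - r) → F) → ℂ),
      QMDS.IsQuantumMDS p (2 * k - r) r (k + 1 - r) Q := by
  subst hF
  obtain ⟨σ, hσ⟩ := QMDS.exists_ringHom_eq_pow hK
  have hN : (M.map σ)ᵀ = -(lam ^ (Fintype.card F + 1)) • M⁻¹ := by
    rw [neg_smul, ← hMsigma]
    exact congrArg (fun f => (M.map f)ᵀ) (funext hσ)
  have hMN : M * (M.map σ)ᵀ = -(lam ^ (Fintype.card F + 1)) • (1 : Matrix (Fin k) (Fin k) K) := by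
    rw [hN, Matrix.mul_smul, Matrix.mul_nonsing_inv _ hM]
  have hNM : (M.map σ)ᵀ * M = -(lam ^ (Fintype.card F + 1)) • (1 : Matrix (Fin k) (Fin k) K) := by
    rw [hN, Matrix.smul_mul, Matrix.nonsing_inv_mul _ hM]
  have hrank : Module.finrank K (QMDS.doubleCode lam M) = k := QMDS.finrank_doubleCode hlam
  have hweight : ∀ v ∈ QMDS.doubleCode lam M, v ≠ 0 → k + 1 ≤ hammingNorm v := fun v hv hv0 =>
    QMDS.le_hammingNorm_of_mem_doubleCode hlam (neg_ne_zero.2 (pow_ne_zero _ hlam)) hMN hminor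
      (fun j h1 h2 => QMDS.det_submatrix_map_transpose_ne_zero σ (hminor j h1 h2)) hv hv0
  have hdual := QMDS.hermitianDual_doubleCode hlam σ hσ hMN hNM
  let i₀ : Fin k := ⟨0, hk⟩
  have hrow := QMDS.row_mem_doubleCode (lam := lam) (M := M) i₀
  have hrow0 : Sum.elim (lam • Pi.single i₀ 1) (M i₀) ≠ 0 := fun h => hlam (by
    simpa using congrFun h (Sum.inl i₀))
  have hmin : QMDS.IsMinDist (QMDS.doubleCode lam M : Set (Fin k ⊕ Fin k → K)) (k + 1) :=
    QMDS.isMinDist_of_hammingNorm hweight ⟨_, hrow, hrow0, QMDS.hammingNorm_row_le i₀ (M i₀)⟩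
  have hlen : Fintype.card (Fin k ⊕ Fin k) = 2 * k := by
    rw [Fintype.card_sum, Fintype.card_fin, two_mul]
  refine ⟨⟨⟨hlen, hrank, hmin⟩, ⟨k + 1, hmin, ?_⟩, hdual⟩, fun r hr => ?_⟩
  · rw [hlen, SetLike.coe_sort_coe, Module.natCard_eq_pow_finrank (K := K), hrank,
      Nat.card_eq_fintype_card]
    congr 1
    omega
  -- All deleted coordinates lie in the right block. A row of `(lam I | M)` keeps its single entry
  -- on the left and at most `k - r` on the right, so its weight is at most `k + 1 - r`.
  · let ε : Fin (2 * k - r) ≃ Fin k ⊕ Fin (k - r) :=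
      (finCongr (by omega)).trans finSumFinEquiv.symm
    have hle : k - r ≤ k := Nat.sub_le k r
    obtain ⟨Q, hQ⟩ := QMDS.exists_isQuantumCode_of_hermitianDual_eq p hK hdual (r := r)
      (n := 2 * k - r) (d := k + 1 - r) hrank hlen
      (fun v hv hv0 => (by omega : k + 1 - r + r ≤ k + 1).trans (hweight v hv hv0))
      (by omega) (by omega) (g := Sum.map id (Fin.castLE hle) ∘ ε)
      ((Function.injective_id.sumMap (Fin.castLE_injective hle)).comp ε.injective)
      hrow hrow0 (by
        rw [← Function.comp_assoc, Sum.elim_comp_map, Function.comp_id]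
        have h1 := QMDS.hammingNorm_add_card_le ε.symm.injective
          ((Sum.elim (lam • Pi.single i₀ 1) (M i₀ ∘ Fin.castLE hle)) ∘ ε)
        rw [Function.comp_assoc, Equiv.self_comp_symm, Function.comp_id,
          Fintype.card_congr ε] at h1
        have h2 := QMDS.hammingNorm_row_le (lam := lam) i₀ (M i₀ ∘ Fin.castLE hle)
        omega)
    exact ⟨Q, hQ, by omega⟩
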